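/- Work over $\mathbb{C}$; let $N\ge 2$, $d\ge 3$, $e\ge 1$. Hypersurfaces are effective divisors (given by nonzero forms up to scalars), and intersections and inclusions are scheme-theoretic. A hypersurface $C$ of degree $d$ in a projective space $\mathbb{P}$ is a \emph{good $P$-cone} if it is a cone with vertex $P\in\mathbb{P}$ and is smooth outside $P$. Let $\mathcal{L}=\{(\Pi_i,P_i,C_i)\}_{i=1}^e$, where $\Pi_i\subset\mathbb{P}^N$ is a hyperplane, $P_i\in\Pi_i$ a point, $C_i$ a good $P_i$-cone of degree $d$ in $\Pi_i$, and $P_i\notin\Pi_j$ for $i\ne j$. Such a family is \emph{suited for degree $d$} if there is a hypersurface $X\subset\mathbb{P}^N$ of degree $d$, containing none of the $\Pi_i$, with $X\cap\Pi_i=C_i$ for all $i$. Let $V_d(\mathcal{L})$ be the space of $s\in\Gamma(\mathbb{P}^N,\mathcal{O}(d))$ with $C_i\subset Z(s)$ for all $i$ (equivalently, $s|_{\Pi_i}$ is a possibly zero scalar multiple of the equation of $C_i$), and $\mathbb{P}_d(\mathcal{L})=\mathbb{P}(V_d(\mathcal{L}))$. For a hyperplane $\Pi$, let $V_{\Pi,d}(\mathcal{L})\subset\Gamma(\Pi,\mathcal{O}_\Pi(d))$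 be the image of $V_d(\mathcal{L})$ under restriction, $\mathbb{P}_{\Pi,d}(\mathcal{L})=\mathbb{P}(V_{\Pi,d}(\mathcal{L}))$, and $\mathbb{P}_{\Pi,k}=\mathbb{P}(\Gamma(\Pi,\mathcal{O}_\Pi(k)))$. Theorem. Assume $\mathcal{L}$ is suited for degree $d$. (i) $\dim\mathbb{P}_d(\mathcal{L})=\binom{d-e+N}{N}$ if $e\le d$, and $\dim\mathbb{P}_d(\mathcal{L})=0$ if $e>d$. If $e\le d$, a general element of $\mathbb{P}_d(\mathcal{L})$ (i.e. every element of some nonempty Zariski open subset) is a smooth hypersurface of degree $d$. (ii) Let $\Pi\subset\mathbb{P}^N$ be a hyperplane with $P_i\notin\Pi$ for all $i$, and let $\Pi_i'=\Pi\cap\Pi_i$. If $e\le d$, then $\dim\mathbb{P}_{\Pi,d}(\mathcal{L})=\binom{d-e+N-1}{N-1}$ and $\mathbb{P}_{\Pi,d}(\mathcal{L})$ contains $\Pi_1'+\cdots+\Pi_e'+\mathbb{P}_{\Pi,d-e}$. If $e>d$, then $\dim\mathbb{P}_{\Pi,d}(\mathcal{L})=0$. (iii) Let $\Pi$ be a hyperplane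 as in (ii), let $P\in\Pi$ be a point with $P\notin\Pi_i$ for all $i$, let $C$ be a good $P$-cone of degree $d$ in $\Pi$, and let $\mathcal{L}'=\mathcal{L}\cup\{(\Pi,P,C)\}$. Then $\mathcal{L}'$ is suited for degree $d$ if and only if $C\in\mathbb{P}_{\Pi,d}(\mathcal{L})$. -/

import Mathlib

noncomputable section

namespace StarPoints

/-- `Γ(ℙ(E), 𝒪(d))` for a complex vector space `E`: the homogeneous polynomial functions of
degree `d` on `E`, i.e. the linear combinations of products of `d` linear functionals. -/
def forms (E : Type*) [AddCommGroup E] [Module ℂ E] (d : ℕ) : Submodule ℂ (E → ℂ) :=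
  Submodule.span ℂ
    (Set.range fun (l : Fin d → Module.Dual ℂ E) (v : E) => ∏ i, l i v)

/-- Hypersurfaces of degree `d` in `ℙ(E)`, as effective divisors (closed subschemes):
nonzero forms of degree `d` up to a scalar. -/
abbrev Hypersurface (E : Type*) [AddCommGroup E] [Module ℂ E] (d : ℕ) : Type _ :=
  Projectivization ℂ (forms E d)

/-- An equation of a hypersurface (well defined up to a nonzero scalar). -/
def Hypersurface.eqn {E : Type*} [AddCommGroup E] [Module ℂ E] {d : ℕ}
    (X : Hypersurface E d) : E → ℂ :=
  (Projectivization.rep X : forms E d)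

/-- The point `[v]` is a singular point of the scheme `f = 0` (Jacobian criterion): `f` and all
its directional derivatives vanish at `v`. -/
def IsSingularAt {E : Type*} [AddCommGroup E] [Module ℂ E] (f : E → ℂ) (v : E) : Prop :=
  f v = 0 ∧ ∀ w : E, lineDeriv ℂ f v w = 0

/-- The scheme `f = 0` in `ℙ(E)` is smooth. -/
def IsSmooth {E : Type*} [AddCommGroup E] [Module ℂ E] (f : E → ℂ) : Prop :=
  ∀ v : E, v ≠ 0 → ¬ IsSingularAt f v

/-- `C` is a good `P`-cone in `ℙ(E)`: it is a cone with vertex `P` (as a scheme, i.e. its equation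
is pulled back along the projection from `P`), and it is smooth outside `P`. -/
structure IsGoodCone {E : Type*} [AddCommGroup E] [Module ℂ E] {d : ℕ}
    (C : Hypersurface E d) (P : Projectivization ℂ E) : Prop where
  cone : ∀ p ∈ P.submodule, ∀ v : E, C.eqn (v + p) = C.eqn v
  smooth : ∀ v : E, v ∉ P.submodule → ¬ IsSingularAt C.eqn v

/-- Restriction of functions to a linear subspace; on forms of degree `d` it is the restriction map
`Γ(ℙ(E), 𝒪(d)) → Γ(Π, 𝒪(d))`. -/
def restrict {E : Type*} [AddCommGroup E] [Module ℂ E] (H : Submodule ℂ E) :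
    (E → ℂ) →ₗ[ℂ] (H → ℂ) :=
  LinearMap.funLeft ℂ ℂ (Subtype.val : H → E)

/-- The linear subspace `H` of `ℙ(E)` is contained in the hypersurface `X`. -/
def Hypersurface.Contains {E : Type*} [AddCommGroup E] [Module ℂ E] {d : ℕ}
    (X : Hypersurface E d) (H : Submodule ℂ E) : Prop :=
  restrict H X.eqn = 0

/-- `X ∩ H = C` as subschemes of `H`. -/
def Hypersurface.InterEq {E : Type*} [AddCommGroup E] [Module ℂ E] {d : ℕ}
    (X : Hypersurface E d) (H : Submodule ℂ E) (C : Hypersurface H d) : Prop :=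
  ∃ a : ℂ, a ≠ 0 ∧ restrict H X.eqn = a • C.eqn

/-- The vector space whose projectivization is `ℙ^N`. -/
abbrev Coord (N : ℕ) : Type := Fin (N + 1) → ℂ

/-- Triples `(Π, P, C)`: a hyperplane `Π` of `ℙ^N`, a point `P` of `Π` and a good `P`-cone `C` of
degree `d` in `Π`. -/
structure Triple (N d : ℕ) where
  plane : Submodule ℂ (Coord N)
  finrank_plane : Module.finrank ℂ plane = N
  point : Projectivization ℂ plane
  cone : Hypersurface plane d
  good : IsGoodCone cone point

/-- The point `P` of the triple `(Π, P, C)` lies on the linear subspace `H` of `ℙ^N`. -/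
def Triple.PointMem {N d : ℕ} (T : Triple N d) (H : Submodule ℂ (Coord N)) : Prop :=
  (T.point.rep : Coord N) ∈ H

/-- `P_i ∉ Π_j` for `i ≠ j`. -/
def PointsOffPlanes {N d e : ℕ} (L : Fin e → Triple N d) : Prop :=
  ∀ i j, i ≠ j → ¬ (L i).PointMem (L j).plane

/-- The family `L` is suited for degree `d`. -/
def Suited {N d e : ℕ} (L : Fin e → Triple N d) : Prop :=
  ∃ X : Hypersurface (Coord N) d,
    (∀ i, ¬ X.Contains (L i).plane) ∧ ∀ i, X.InterEq (L i).plane (L i).cone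

/-- `V_d(L)`: the forms `s` of degree `d` with `C_i ⊆ Z(s)` for all `i`, as schemes. Since `s` and
`C_i` have the same degree, the restriction of `s` to `Π_i` lies in the homogeneous ideal of `C_i`
iff it is a scalar multiple (possibly zero) of the equation of `C_i`. -/
def sysSpace {N d e : ℕ} (L : Fin e → Triple N d) : Submodule ℂ (Coord N → ℂ) :=
  forms (Coord N) d ⊓
    ⨅ i, (Submodule.span ℂ {(L i).cone.eqn}).comap (restrict (L i).plane)

/-- `V_{Π,d}(L)`: the image of `V_d(L)` under restriction to `Π`. -/
def restrictedSpace {N d e : ℕ} (L : Fin e → Triple N d) (H : Submodule ℂ (Coord N)) :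
    Submodule ℂ (H → ℂ) :=
  (sysSpace L).map (restrict H)

/-- The dimension of the projectivization of a vector space (`-1` for the empty one). -/
def projDim (V : Type*) [AddCommGroup V] [Module ℂ V] : ℤ :=
  (Module.finrank ℂ V : ℤ) - 1

/-- Zariski closed subsets of `ℙ(V)`: common zero loci of sets of homogeneous polynomial
functions. -/
def IsZariskiClosed {V : Type*} [AddCommGroup V] [Module ℂ V]
    (Z : Set (Projectivization ℂ V)) : Prop :=
  ∃ S : Set (V → ℂ), (∀ φ ∈ S, ∃ n, φ ∈ forms V n) ∧ Z = {x | ∀ φ ∈ S, φ x.rep = 0}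

/-- A general member of the linear system `ℙ(V)` satisfies `p`: all members in some nonempty
Zariski open subset do. -/
def GeneralMember {E : Type*} [AddCommGroup E] [Module ℂ E] (V : Submodule ℂ (E → ℂ))
    (p : (E → ℂ) → Prop) : Prop :=
  ∃ U : Set (Projectivization ℂ V), IsZariskiClosed Uᶜ ∧ U.Nonempty ∧
    ∀ x ∈ U, p (x.rep : V)

end StarPoints

end

/-! Let `l i` be an equation of `Π_i` and `F` the form provided by suitedness. A member `s` of
`V_d(L)` equals a multiple `c_i F` on each `Π_i`. The scalars agree: since `P_i ∉ Π_j`, translating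
along the vertex shows that the cone `C_i` does not contain `Π_i ∩ Π_j`, so `c_i` and `c_j` can be
compared at a point there with `F ≠ 0` (`exists_sub_vanish`). Hence some `s - b F` vanishes on every
`Π_i` and is divisible by `∏ l i`. So `V_d(L)` is `ℂF` plus the multiples of `∏ l i` of degree `d`,
or just `ℂF` if `e > d` (`sysSpace_eq`, `sysSpace_eq_of_lt`).

The dimensions follow, also after restriction to `Π`: as `P_i ∉ Π`, neither `l i` on `Π` nor `F` on
`Π ∩ Π_i` vanishes identically. For (iii), a member restricting to the equation of `C` has `b ≠ 0`,
hence already cuts out every `C_i`.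

For smoothness, Bertini confines the singular points of a general member to the base locus, which
lies in `⋃ Π_i` because of the multiples of `∏ l i`. When `b ≠ 0` the member cuts `C_i` on `Π_i`, so
only `P_i` can be singular, and there a derivative transversal to `Π_i` is generically nonzero.

Bertini is proved algebraically. At a closed singular point `v` of the generic member `∑ t_i b_i`,
the derivation `∂/∂t_i` extends to the residue field, and applying it to `∑ t_i b_i(v) = 0` leaves
`b_i(v) = 0`. Clearing denominators passes to special parameters. -/

namespace StarPoints

open MvPolynomial

/-! ### Bertini's theorem in characteristic zero -/

section Bertini

/-- Derivations extend along formally étale algebras. -/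
theorem exists_derivation_extend (R S T : Type*) [CommRing R] [CommRing S] [CommRing T]
    [Algebra R S] [Algebra R T] [Algebra S T] [IsScalarTower R S T] [Algebra.FormallyEtale S T]
    (d : Derivation R S S) :
    ∃ D : Derivation R T T, ∀ s, D (algebraMap S T s) = algebraMap S T (d s) := by
  let φ : Ω[S⁄R] →ₗ[S] T := (Algebra.linearMap S T).comp d.liftKaehlerDifferential
  let ψ : Ω[T⁄R] →ₗ[T] T := (φ.liftBaseChange T).comp
    (KaehlerDifferential.tensorKaehlerEquivOfFormallyEtale R S T).symm.toLinearMap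
  refine ⟨ψ.compDer (KaehlerDifferential.D R T), fun s => ?_⟩
  simp [ψ, φ, KaehlerDifferential.tensorKaehlerEquivOfFormallyEtale_symm_D_algebraMap]

/-- The chain rule for derivations and multivariate polynomials. -/
theorem derivation_aeval {R A σ : Type*} [CommRing R] [CommRing A] [Algebra R A] [Fintype σ]
    (D : Derivation R A A) (v : σ → A) (p : MvPolynomial σ R) :
    D (aeval v p) = ∑ j, aeval v (pderiv j p) * D (v j) := by
  classical
  induction p using MvPolynomial.induction_on with
  | C a => simp
  | add p q hp hq => simp [hp, hq, add_mul, Finset.sum_add_distrib]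
  | mul_X p i hp =>
    simp only [map_mul, aeval_X, Derivation.leibniz, smul_eq_mul, hp, map_add, add_mul,
      Finset.sum_add_distrib, pderiv_X, Pi.single_apply, Finset.mul_sum]
    congr 1
    · simp [Finset.sum_ite_eq, apply_ite (aeval v)]
    · exact Finset.sum_congr rfl fun j _ => by ring

variable {ι σ : Type*} [Fintype ι] [Fintype σ]

/-- A singular point of the generic member of a linear system is a base point. -/
theorem aeval_eq_zero_of_singular_generic {k K : Type*} [Field k] [Field K] [Algebra k K]
    [Algebra (MvPolynomial ι k) K] [IsScalarTower k (MvPolynomial ι k) K]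
    [Algebra.FormallyEtale (MvPolynomial ι k) K] (b : ι → MvPolynomial σ k) (v : σ → K)
    (h : ∀ j, ∑ i, algebraMap (MvPolynomial ι k) K (X i) * aeval v (pderiv j (b i)) = 0)
    (h0 : ∑ i, algebraMap (MvPolynomial ι k) K (X i) * aeval v (b i) = 0) (i : ι) :
    aeval v (b i) = 0 := by
  classical
  obtain ⟨D, hD⟩ := exists_derivation_extend k (MvPolynomial ι k) K (pderiv i)
  have key := congrArg D h0
  simp only [map_sum, Derivation.leibniz, hD, smul_eq_mul, derivation_aeval, map_zero,
    Finset.sum_add_distrib, pderiv_X, Pi.single_apply] at key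
  have h1 : ∑ x, algebraMap (MvPolynomial ι k) K (X x) *
      ∑ j, aeval v (pderiv j (b x)) * D (v j) = 0 := by
    simp only [Finset.mul_sum]
    rw [Finset.sum_comm]
    refine Finset.sum_eq_zero fun j _ => ?_
    simp only [← mul_assoc]
    rw [← Finset.sum_mul, h j, zero_mul]
  rw [h1, zero_add] at key
  simpa [apply_ite (algebraMap (MvPolynomial ι k) K), Finset.sum_ite_eq] using key

/-- Generic member of the linear system spanned by the `b i`. -/
noncomputable def genericMember {k : Type*} [CommRing k] (b : ι → MvPolynomial σ k) :
    MvPolynomial σ (MvPolynomial ι k) :=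
  ∑ i, C (X i) * map C (b i)

/-- The ideal of the singular scheme of the generic member. -/
noncomputable def singularIdeal {k : Type*} [CommRing k] (b : ι → MvPolynomial σ k) :
    Ideal (MvPolynomial σ (MvPolynomial ι k)) :=
  Ideal.span (insert (genericMember b) (Set.range fun j => pderiv j (genericMember b)))

/-- By the Jacobson property it suffices to argue modulo each maximal ideal over the singular ideal.
The residue field is finite over `F` by the Nullstellensatz and separable in characteristic zero,
hence formally étale over `k[t]`, so the derivation argument applies. -/
theorem map_mem_radical_map_singularIdeal {k F : Type*} [Field k] [CharZero k] [Field F]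
    [Algebra (MvPolynomial ι k) F] [IsFractionRing (MvPolynomial ι k) F]
    (b : ι → MvPolynomial σ k) (i : ι) :
    map (algebraMap (MvPolynomial ι k) F) (map C (b i)) ∈
      ((singularIdeal b).map (map (σ := σ) (algebraMap (MvPolynomial ι k) F))).radical := by
  rw [Ideal.radical_eq_jacobson, Ideal.jacobson, Ideal.mem_sInf]
  rintro M ⟨hJM, hM⟩
  let K := MvPolynomial σ F ⧸ M
  let : Field K := Ideal.Quotient.field M
  let : Algebra k F := ((algebraMap (MvPolynomial ι k) F).comp C).toAlgebra
  have : IsScalarTower k (MvPolynomial ι k) F := .of_algebraMap_eq fun _ => rfl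
  have : IsScalarTower k (MvPolynomial ι k) K := .of_algebraMap_eq fun _ => rfl
  have : CharZero F := charZero_of_injective_algebraMap (algebraMap k F).injective
  have : Algebra.FiniteType F K :=
    Algebra.FiniteType.of_surjective (Ideal.Quotient.mkₐ F M) (Ideal.Quotient.mkₐ_surjective F M)
  have : Module.Finite F K := finite_of_finite_type_of_isJacobsonRing F K
  have : Algebra.FormallyEtale F K := Algebra.FormallyEtale.of_isSeparable F K
  have : Algebra.FormallyEtale (MvPolynomial ι k) F :=
    Algebra.FormallyEtale.of_isLocalization (nonZeroDivisors (MvPolynomial ι k))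
  have : Algebra.FormallyEtale (MvPolynomial ι k) K := Algebra.FormallyEtale.comp _ F K
  let v : σ → K := fun j => Ideal.Quotient.mk M (X j)
  have hv : ∀ p : MvPolynomial σ k,
      Ideal.Quotient.mk M (map (algebraMap (MvPolynomial ι k) F) (map C p)) = aeval v p := by
    intro p
    induction p using MvPolynomial.induction_on with
    | C a => simp only [map_C, algHom_C]; rfl
    | add p q hp hq => simp [hp, hq]
    | mul_X p i hp => simp [hp, v]
  have hX : ∀ i : ι, Ideal.Quotient.mk M (map (algebraMap (MvPolynomial ι k) F) (C (X i))) =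
      algebraMap (MvPolynomial ι k) K (X i) := by
    intro i
    simp only [map_C]; rfl
  have hmem : ∀ x ∈ singularIdeal b,
      Ideal.Quotient.mk M (map (algebraMap (MvPolynomial ι k) F) x) = 0 := fun x hx =>
    Ideal.Quotient.eq_zero_iff_mem.mpr (hJM (Ideal.mem_map_of_mem _ hx))
  rw [← Ideal.Quotient.eq_zero_iff_mem, hv]
  refine aeval_eq_zero_of_singular_generic b v (fun j => ?_) ?_ i
  · have := hmem _ (Ideal.subset_span (Or.inr ⟨j, rfl⟩))
    simpa only [genericMember, map_sum, Derivation.leibniz, pderiv_C, mul_zero, add_zero,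
      smul_eq_mul, map_mul, hX, pderiv_map, hv] using this
  · have := hmem _ (Ideal.subset_span (Or.inl rfl))
    simpa only [genericMember, map_sum, map_mul, hX, hv] using this

attribute [local instance] MvPolynomial.algebraMvPolynomial in
/-- Bertini's theorem: outside a hypersurface in the parameter space, all singular points of
the members of a linear system are base points. -/
theorem exists_singular_imp_base {k : Type*} [Field k] [CharZero k] (b : ι → MvPolynomial σ k) :
    ∃ q : MvPolynomial ι k, q ≠ 0 ∧ ∀ t : ι → k, eval t q ≠ 0 → ∀ v : σ → k,
      eval v (∑ i, t i • b i) = 0 → (∀ j, eval v (pderiv j (∑ i, t i • b i)) = 0) →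
      ∀ i, eval v (b i) = 0 := by
  have key : ∀ i, ∃ q : MvPolynomial ι k, q ≠ 0 ∧ ∃ n : ℕ,
      map C (b i) ^ n * C q ∈ singularIdeal b := by
    intro i
    obtain ⟨n, hn⟩ := map_mem_radical_map_singularIdeal (F := FractionRing (MvPolynomial ι k)) b i
    rw [← map_pow, ← MvPolynomial.algebraMap_def] at hn
    -- `k(t)[x]` is the localization of `k[t][x]` at the nonzero constants `q ∈ k[t]`, so the
    -- denominators involve the parameters only.
    rw [IsLocalization.mem_map_algebraMap_iff
      ((nonZeroDivisors (MvPolynomial ι k)).map (C (σ := σ)))] at hn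
    obtain ⟨⟨a, ⟨_, q, hq, rfl⟩⟩, h⟩ := hn
    refine ⟨q, nonZeroDivisors.ne_zero hq, n, ?_⟩
    rw [← map_mul] at h
    have hinj : Function.Injective (algebraMap (MvPolynomial σ (MvPolynomial ι k))
        (MvPolynomial σ (FractionRing (MvPolynomial ι k)))) := by
      rw [MvPolynomial.algebraMap_def]
      exact map_injective _ (IsFractionRing.injective _ _)
    rw [hinj h]
    exact a.2
  choose q hq n hn using key
  refine ⟨∏ i, q i, Finset.prod_ne_zero_iff.mpr fun i _ => hq i, fun t ht v h0 h1 i => ?_⟩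
  rw [map_prod, Finset.prod_ne_zero_iff] at ht
  -- Specialization of the parameters to `t` and of the coordinates to `v`; it kills the singular
  -- ideal exactly because `v` is singular on the member `t`.
  let φ : MvPolynomial σ (MvPolynomial ι k) →+* k := eval₂Hom (eval t) v
  have hφ : ∀ p : MvPolynomial σ k, φ (map C p) = eval v p := by
    intro p
    simp only [φ, coe_eval₂Hom, eval₂_map, eval]
    congr 1
    ext; simp
  have hφX : ∀ i, φ (C (X i)) = t i := fun i => by simp [φ]
  have hle : singularIdeal b ≤ RingHom.ker φ := by
    rw [singularIdeal, Ideal.span_le]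
    rintro _ (rfl | ⟨j, rfl⟩)
    · simpa only [SetLike.mem_coe, RingHom.mem_ker, genericMember, map_sum, map_mul, hφ, hφX,
        smul_eval] using h0
    · simpa only [SetLike.mem_coe, RingHom.mem_ker, genericMember, map_sum, Derivation.leibniz,
        pderiv_C, mul_zero, add_zero, smul_eq_mul, map_mul, pderiv_map, hφ, hφX,
        Derivation.map_smul, smul_eval] using h1 j
  have := hle (hn i)
  rw [RingHom.mem_ker, map_mul, map_pow, hφ] at this
  rcases mul_eq_zero.mp this with h | h
  · exact eq_zero_of_pow_eq_zero h
  · exact absurd (by simpa [φ] using h) (ht i (Finset.mem_univ i))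

end Bertini

/-! ### Forms: products, lines, divisibility by linear equations -/

section Forms

variable {E : Type*} [AddCommGroup E] [Module ℂ E] {E' : Type*} [AddCommGroup E'] [Module ℂ E']

theorem prod_mem_forms {d : ℕ} (l : Fin d → Module.Dual ℂ E) :
    (fun v => ∏ i, l i v) ∈ forms E d :=
  Submodule.subset_span ⟨l, rfl⟩

theorem one_mem_forms : (1 : E → ℂ) ∈ forms E 0 := by
  simpa using! prod_mem_forms (E := E) (Fin.elim0)

theorem dual_mem_forms (l : Module.Dual ℂ E) : (fun v => l v) ∈ forms E 1 := by
  simpa using prod_mem_forms (E := E) (fun _ : Fin 1 => l)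

theorem mul_mem_forms {a b : ℕ} {f g : E → ℂ} (hf : f ∈ forms E a) (hg : g ∈ forms E b) :
    f * g ∈ forms E (a + b) := by
  induction hf using Submodule.span_induction with
  | zero => simp
  | add x y _ _ hx hy => rw [add_mul]; exact add_mem hx hy
  | smul c x _ hx => rw [smul_mul_assoc]; exact Submodule.smul_mem _ _ hx
  | mem x hx =>
    obtain ⟨l, rfl⟩ := hx
    induction hg using Submodule.span_induction with
    | zero => simp
    | add x y _ _ hx hy => rw [mul_add]; exact add_mem hx hy
    | smul c x _ hx => rw [mul_smul_comm]; exact Submodule.smul_mem _ _ hx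
    | mem x hx =>
      obtain ⟨m, rfl⟩ := hx
      convert! prod_mem_forms (Fin.append l m) using 1
      ext v
      simp [Fin.prod_univ_add]

theorem prod_mul_mem_forms {e m : ℕ} (l : Fin e → Module.Dual ℂ E) {g : E → ℂ}
    (hg : g ∈ forms E m) : (fun v => (∏ i, l i v) * g v) ∈ forms E (e + m) :=
  mul_mem_forms (prod_mem_forms l) hg

theorem pow_mem_forms {a : ℕ} {f : E → ℂ} (hf : f ∈ forms E a) (n : ℕ) :
    f ^ n ∈ forms E (n * a) := by
  induction n with
  | zero => simpa using one_mem_forms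
  | succ n ih => rw [pow_succ, add_mul, one_mul]; exact mul_mem_forms ih hf

theorem comp_mem_forms {d : ℕ} {f : E → ℂ} (hf : f ∈ forms E d) (φ : E' →ₗ[ℂ] E) :
    (fun v => f (φ v)) ∈ forms E' d := by
  induction hf using Submodule.span_induction with
  | zero => exact zero_mem _
  | add x y _ _ hx hy => exact add_mem hx hy
  | smul c x _ hx => exact Submodule.smul_mem _ c hx
  | mem x hx =>
    obtain ⟨l, rfl⟩ := hx
    exact prod_mem_forms fun i => (l i).comp φ

theorem restrict_mem_forms {d : ℕ} {f : E → ℂ} (hf : f ∈ forms E d) (H : Submodule ℂ E) :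
    restrict H f ∈ forms H d :=
  comp_mem_forms hf H.subtype

theorem exists_restrict_eq {d : ℕ} (H : Submodule ℂ E) {g : H → ℂ} (hg : g ∈ forms H d) :
    ∃ f ∈ forms E d, restrict H f = g := by
  obtain ⟨π, hπ⟩ := H.subtype.exists_leftInverse_of_injective (by simp)
  refine ⟨_, comp_mem_forms hg π, ?_⟩
  ext v
  exact congrArg g (LinearMap.congr_fun hπ v)

/-- Forms restrict to polynomials on lines. -/
theorem exists_polynomial_on_line {d : ℕ} {f : E → ℂ} (hf : f ∈ forms E d) (v w : E) :
    ∃ p : Polynomial ℂ, ∀ t : ℂ, f (v + t • w) = p.eval t := by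
  induction hf using Submodule.span_induction with
  | zero => exact ⟨0, by simp⟩
  | add x y _ _ hx hy =>
    obtain ⟨p, hp⟩ := hx
    obtain ⟨q, hq⟩ := hy
    exact ⟨p + q, by simp [hp, hq]⟩
  | smul c x _ hx =>
    obtain ⟨p, hp⟩ := hx
    exact ⟨c • p, by simp [hp]⟩
  | mem x hx =>
    obtain ⟨l, rfl⟩ := hx
    exact ⟨∏ i, (Polynomial.C (l i v) + Polynomial.X * Polynomial.C (l i w)),
      fun t => by simp only [Polynomial.eval_prod, map_add, map_smul, Polynomial.eval_add,
        Polynomial.eval_C, Polynomial.eval_mul, Polynomial.eval_X, smul_eq_mul]⟩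

/-- Restricting to the line joining a point with `f ≠ 0` to one with `g ≠ 0` reduces this to `ℂ[X]`
being a domain. -/
theorem forms_mul_eq_zero {a b : ℕ} {f g : E → ℂ} (hf : f ∈ forms E a) (hg : g ∈ forms E b)
    (h : ∀ v, f v * g v = 0) : f = 0 ∨ g = 0 := by
  by_contra! hfg
  obtain ⟨v, hv⟩ := Function.ne_iff.mp hfg.1
  obtain ⟨w, hw⟩ := Function.ne_iff.mp hfg.2
  obtain ⟨p, hp⟩ := exists_polynomial_on_line hf v (w - v)
  obtain ⟨q, hq⟩ := exists_polynomial_on_line hg v (w - v)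
  have hpq : p * q = 0 := Polynomial.funext fun t => by
    rw [Polynomial.eval_mul, ← hp, ← hq, h, Polynomial.eval_zero]
  rcases mul_eq_zero.mp hpq with h | h
  · exact hv (by simpa [h] using hp 0)
  · exact hw (by simpa [h] using hq 1)

theorem exists_form_ne_zero (m : ℕ) {v : E} (hv : v ≠ 0) : ∃ g ∈ forms E m, g v ≠ 0 := by
  obtain ⟨l, hl⟩ := Module.Projective.exists_dual_ne_zero ℂ hv
  exact ⟨_, prod_mem_forms fun _ => l, by simp [hl]⟩

theorem form_smul {d : ℕ} {f : E → ℂ} (hf : f ∈ forms E d) (c : ℂ) (v : E) :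
    f (c • v) = c ^ d * f v := by
  induction hf using Submodule.span_induction with
  | zero => simp
  | add x y _ _ hx hy => simp [hx, hy, mul_add]
  | smul c x _ hx => simp only [Pi.smul_apply, smul_eq_mul, hx]; ring
  | mem x hx =>
    obtain ⟨l, rfl⟩ := hx
    simp [Finset.prod_mul_distrib]

/-- A form composed with the projection `v ↦ v - l v • w` is congruent to itself modulo `l`. -/
theorem exists_sub_comp_proj_eq (l : Module.Dual ℂ E) (w : E) {d : ℕ} {f : E → ℂ}
    (hf : f ∈ forms E (d + 1)) :
    ∃ g ∈ forms E d, ∀ v, f v - f (v - l v • w) = l v * g v := by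
  induction hf using Submodule.span_induction with
  | zero => exact ⟨0, zero_mem _, by simp⟩
  | add x y _ _ hx hy =>
    obtain ⟨p, hp, hp'⟩ := hx
    obtain ⟨q, hq, hq'⟩ := hy
    refine ⟨p + q, add_mem hp hq, fun v => ?_⟩
    simp only [Pi.add_apply]
    linear_combination hp' v + hq' v
  | smul c x _ hx =>
    obtain ⟨p, hp, hp'⟩ := hx
    refine ⟨c • p, Submodule.smul_mem _ _ hp, fun v => ?_⟩
    simp only [Pi.smul_apply, smul_eq_mul]
    linear_combination c * hp' v
  | mem x hx =>
    obtain ⟨m, rfl⟩ := hx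
    induction d with
    | zero => exact ⟨fun _ => m 0 w, by
        simpa [Pi.smul_def] using Submodule.smul_mem (forms E 0) (m 0 w) one_mem_forms,
        fun v => by simp⟩
    | succ d ih =>
      obtain ⟨g, hg, hg'⟩ := ih (Fin.tail m)
      -- Discrete product rule: split the difference into the change of the remaining factors, times
      -- `m 0 v`, and the change `l v * m 0 w` of the first one.
      refine ⟨(fun v => m 0 v) * g + m 0 w • fun v => ∏ i, Fin.tail m i (v - l v • w),
        add_mem ?_ (Submodule.smul_mem _ _ ?_), fun v => ?_⟩
      · rw [mul_comm]
        exact mul_mem_forms hg (dual_mem_forms (m 0))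
      · exact comp_mem_forms (prod_mem_forms (Fin.tail m)) (LinearMap.id - l.smulRight w)
      · have := hg' v
        simp only [Fin.prod_univ_succ (n := d + 1), Pi.add_apply, Pi.mul_apply, Pi.smul_apply,
          smul_eq_mul, map_sub, map_smul] at this ⊢
        simp only [Fin.tail] at this ⊢
        linear_combination m 0 v * this

theorem forms_zero_eq {f : E → ℂ} (hf : f ∈ forms E 0) (v w : E) : f v = f w := by
  induction hf using Submodule.span_induction with
  | zero => simp
  | add x y _ _ hx hy => simp [hx, hy]
  | smul c x _ hx => simp [hx]
  | mem x hx =>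
    obtain ⟨l, rfl⟩ := hx
    simp

/-- A form vanishing on a hyperplane is divisible by the equation of the hyperplane. -/
theorem exists_eq_mul_of_vanish {l : Module.Dual ℂ E} (hl : l ≠ 0) {d : ℕ} {f : E → ℂ}
    (hf : f ∈ forms E d) (h : ∀ v, l v = 0 → f v = 0) :
    f = 0 ∨ ∃ m, d = m + 1 ∧ ∃ g ∈ forms E m, ∀ v, f v = l v * g v := by
  cases d with
  | zero =>
    left
    ext v
    rw [forms_zero_eq hf v 0]
    exact h 0 (map_zero l)
  | succ d =>
    right
    obtain ⟨w, hw⟩ := DFunLike.ne_iff.mp hl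
    -- With `w` rescaled so that `l` takes the value 1, `v - l v • w` lies in the hyperplane, where
    -- `f` vanishes.
    obtain ⟨g, hg, hg'⟩ := exists_sub_comp_proj_eq l ((l w)⁻¹ • w) hf
    refine ⟨d, rfl, g, hg, fun v => ?_⟩
    rw [← hg' v, h (v - _) (by simp [inv_mul_cancel₀ (show l w ≠ 0 from hw)]), sub_zero]

/-- A form vanishing on finitely many distinct hyperplanes is divisible by the product of their
equations. -/
theorem exists_eq_prod_mul_of_vanish {e : ℕ} (l : Fin e → Module.Dual ℂ E) (hl0 : ∀ i, l i ≠ 0)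
    (hl : ∀ i j, i ≠ j → ∃ v, l i v = 0 ∧ l j v ≠ 0) {d : ℕ} {f : E → ℂ}
    (hf : f ∈ forms E d) (h : ∀ i v, l i v = 0 → f v = 0) :
    f = 0 ∨ ∃ m, d = e + m ∧ ∃ g ∈ forms E m, ∀ v, f v = (∏ i, l i v) * g v := by
  induction e generalizing d f with
  | zero => exact Or.inr ⟨d, by simp, f, hf, by simp⟩
  | succ e ih =>
    rcases exists_eq_mul_of_vanish (hl0 0) hf (h 0) with h0 | ⟨m, rfl, g, hg, hg'⟩
    · exact Or.inl h0
    have hgv : ∀ (i : Fin e) (v : E), l i.succ v = 0 → g v = 0 := by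
      intro i
      let K := LinearMap.ker (l i.succ)
      have hK : restrict K (fun v => l 0 v) = 0 ∨ restrict K g = 0 :=
        forms_mul_eq_zero (restrict_mem_forms (dual_mem_forms (l 0)) K) (restrict_mem_forms hg K)
          fun v => (hg' v).symm.trans (h i.succ v v.2)
      rcases hK with hK | hK
      · obtain ⟨v, hv, hv'⟩ := hl i.succ 0 (Fin.succ_ne_zero i)
        exact absurd (congrFun hK ⟨v, hv⟩) hv'
      · exact fun v hv => congrFun hK ⟨v, hv⟩
    rcases ih (fun i => l i.succ) (fun i => hl0 _)
      (fun i j hij => hl _ _ fun h => hij (Fin.succ_injective _ h)) hg hgv with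
      h0 | ⟨m', rfl, g', hg1, hg2⟩
    · left
      ext v
      simp [hg', h0]
    · refine Or.inr ⟨m', by ring, g', hg1, fun v => ?_⟩
      rw [hg', hg2, Fin.prod_univ_succ, mul_assoc]

end Forms

/-! ### Forms as homogeneous polynomials, and their dimension -/

section Dimension

variable {E : Type*} [AddCommGroup E] [Module ℂ E]

/-- Homogeneous polynomials in linear functionals are forms. -/
theorem eval_mem_forms {σ : Type*} (l : σ → Module.Dual ℂ E) {n : ℕ} {q : MvPolynomial σ ℂ}
    (hq : q.IsHomogeneous n) : (fun v => eval (fun i => l i v) q) ∈ forms E n := by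
  classical
  have hsum : (fun v => eval (fun i => l i v) q) =
      ∑ s ∈ q.support, q.coeff s • fun v => ∏ i ∈ s.support, l i v ^ s i := by
    ext v
    simp [eval_eq]
  rw [hsum]
  refine Submodule.sum_mem _ fun s hs => Submodule.smul_mem _ _ ?_
  have hs' : ∑ i ∈ s.support, s i = n := by
    have := hq (mem_support_iff.mp hs)
    simpa [Finsupp.weight_apply, Finsupp.sum] using this
  have key : ∀ t : Finset σ, (fun v => ∏ i ∈ t, l i v ^ s i) ∈ forms E (∑ i ∈ t, s i) := by
    intro t
    induction t using Finset.induction_on with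
    | empty => simpa using! one_mem_forms
    | insert i t hi ih =>
      simp only [Finset.prod_insert hi, Finset.sum_insert hi]
      have := pow_mem_forms (dual_mem_forms (l i)) (s i)
      rw [mul_one] at this
      exact mul_mem_forms this ih
  simpa [hs'] using key s.support

variable {n : ℕ} (B : Module.Basis (Fin n) ℂ E)

/-- The polynomial function on `E` given by a polynomial in the coordinates. -/
noncomputable def polyFun : MvPolynomial (Fin n) ℂ →ₗ[ℂ] (E → ℂ) where
  toFun q v := eval (fun i => B.coord i v) q
  map_add' p q := by ext; simp
  map_smul' c p := by ext; simp

theorem polyFun_injective : Function.Injective (polyFun B) := by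
  intro p q h
  refine MvPolynomial.funext fun x => ?_
  have hx : (fun i => B.coord i (B.equivFun.symm x)) = x := B.equivFun.apply_symm_apply x
  simpa only [polyFun, LinearMap.coe_mk, AddHom.coe_mk, hx] using congrFun h (B.equivFun.symm x)

theorem map_polyFun_homogeneousSubmodule (d : ℕ) :
    (homogeneousSubmodule (Fin n) ℂ d).map (polyFun B) = forms E d := by
  apply le_antisymm
  · rintro _ ⟨q, hq, rfl⟩
    exact eval_mem_forms _ hq
  · rw [forms, Submodule.span_le]
    rintro _ ⟨l, rfl⟩
    refine ⟨∏ i, ∑ j, C (l i (B j)) * X j, ?_, ?_⟩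
    · have := IsHomogeneous.prod Finset.univ (fun i => ∑ j, C (l i (B j)) * X j) (fun _ => 1)
        (fun i _ => IsHomogeneous.sum _ _ _ fun j _ => by
          simpa using (isHomogeneous_C (Fin n) (l i (B j))).mul (isHomogeneous_X ℂ j))
      simpa using this
    · ext v
      simp only [polyFun, LinearMap.coe_mk, AddHom.coe_mk, map_prod, map_sum, map_mul, eval_C,
        eval_X]
      refine Finset.prod_congr rfl fun i _ => ?_
      conv_rhs => rw [← B.sum_repr v]
      simp only [map_sum, map_smul, smul_eq_mul, Module.Basis.coord_apply]
      exact Finset.sum_congr rfl fun j _ => mul_comm _ _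

theorem finrank_homogeneousSubmodule (n d : ℕ) :
    Module.finrank ℂ (homogeneousSubmodule (Fin n) ℂ d) = (n + d - 1).choose d := by
  rw [homogeneousSubmodule_eq_finsupp_supported,
    (AddMonoidAlgebra.supportedEquivFinsupp _).finrank_eq]
  have hset : {s : Fin n →₀ ℕ | s.degree = d} =
      ((Finset.univ : Finset (Fin n)).finsuppAntidiag d : Set (Fin n →₀ ℕ)) := by
    ext s
    simp [Finset.mem_finsuppAntidiag, Finsupp.degree_eq_sum]
  rw [hset, Module.finrank_finsupp_self]
  simp [Finset.card_finsuppAntidiag_nat_eq_choose]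

theorem finrank_forms (B : Module.Basis (Fin n) ℂ E) (d : ℕ) :
    Module.finrank ℂ (forms E d) = (n + d - 1).choose d := by
  rw [← map_polyFun_homogeneousSubmodule B,
    ← (Submodule.equivMapOfInjective _ (polyFun_injective B) _).finrank_eq,
    finrank_homogeneousSubmodule]

end Dimension

/-! ### Multiples of a product of linear forms -/

section LinearSystem

variable {E : Type*} [AddCommGroup E] [Module ℂ E]

/-- The products of a form of degree `m` with the linear forms `l i`. -/
noncomputable def prodSpace {e : ℕ} (l : Fin e → Module.Dual ℂ E) (m : ℕ) :
    Submodule ℂ (E → ℂ) :=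
  (forms E m).map (LinearMap.mulLeft ℂ fun v => ∏ i, l i v)

theorem mem_prodSpace {e : ℕ} {l : Fin e → Module.Dual ℂ E} {m : ℕ} {f : E → ℂ} :
    f ∈ prodSpace l m ↔ ∃ g ∈ forms E m, ∀ v, f v = (∏ i, l i v) * g v := by
  constructor
  · rintro ⟨g, hg, rfl⟩
    exact ⟨g, hg, fun v => rfl⟩
  · rintro ⟨g, hg, h⟩
    exact ⟨g, hg, (funext h).symm⟩

theorem forms_finite [FiniteDimensional ℂ E] (d : ℕ) : FiniteDimensional ℂ (forms E d) := by
  rw [← map_polyFun_homogeneousSubmodule (Module.finBasis ℂ E)]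
  have := Module.Finite.iff_fg.mpr (homogeneousSubmodule_fg (Fin (Module.finrank ℂ E)) ℂ d)
  infer_instance

theorem prod_dual_ne_zero {e : ℕ} {l : Fin e → Module.Dual ℂ E} (hl : ∀ i, l i ≠ 0) :
    (fun v => ∏ i, l i v) ≠ 0 := by
  induction e with
  | zero => exact Function.ne_iff.mpr ⟨0, by simp⟩
  | succ e ih =>
    intro h
    rcases forms_mul_eq_zero (dual_mem_forms (l 0)) (prod_mem_forms fun i => l i.succ)
      (fun v => by simpa [Fin.prod_univ_succ] using congrFun h v) with h | h
    · exact hl 0 (LinearMap.ext fun v => congrFun h v)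
    · exact ih (fun i => hl _) h

theorem finrank_prodSpace {e : ℕ} {l : Fin e → Module.Dual ℂ E} (hl : ∀ i, l i ≠ 0) (m : ℕ) :
    Module.finrank ℂ (prodSpace l m) = Module.finrank ℂ (forms E m) := by
  let φ := (LinearMap.mulLeft ℂ fun v => ∏ i, l i v).domRestrict (forms E m)
  have hφ : Function.Injective φ := by
    rw [← LinearMap.ker_eq_bot, LinearMap.ker_eq_bot']
    rintro ⟨g, hg⟩ h
    rcases forms_mul_eq_zero (prod_mem_forms l) hg (congrFun h) with h | h
    · exact absurd h (prod_dual_ne_zero hl)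
    · exact Subtype.ext h
  have hr : prodSpace l m = LinearMap.range φ := by
    rw [prodSpace, LinearMap.range_domRestrict]
  rw [hr]
  exact LinearMap.finrank_range_of_inj hφ

/-- The dimension of the linear system spanned by one form and the multiples of a product of
linear forms. -/
theorem finrank_span_sup_prodSpace [FiniteDimensional ℂ E] {e : ℕ}
    {l : Fin e → Module.Dual ℂ E} (hl : ∀ i, l i ≠ 0) (m : ℕ) {F : E → ℂ}
    (hF : ∃ i v, l i v = 0 ∧ F v ≠ 0) :
    Module.finrank ℂ (Submodule.span ℂ {F} ⊔ prodSpace l m : Submodule ℂ (E → ℂ)) =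
      Module.finrank ℂ (forms E m) + 1 := by
  obtain ⟨i, v, hv, hFv⟩ := hF
  have := forms_finite (E := E) m
  have : FiniteDimensional ℂ (prodSpace l m) := by unfold prodSpace; infer_instance
  have hF0 : F ≠ 0 := fun h => hFv (by simp [h])
  -- Every multiple of the product vanishes at `v`, whereas `F` does not.
  have hinf : Submodule.span ℂ {F} ⊓ prodSpace l m = ⊥ := by
    rw [eq_bot_iff]
    rintro _ ⟨h1, h2⟩
    obtain ⟨c, rfl⟩ := Submodule.mem_span_singleton.mp h1
    obtain ⟨g, -, hg⟩ := mem_prodSpace.mp h2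
    have := hg v
    rw [Finset.prod_eq_zero (Finset.mem_univ i) hv] at this
    have hc : c = 0 := by simpa [hFv] using this
    simp [hc]
  have := Submodule.finrank_sup_add_finrank_inf_eq (Submodule.span ℂ {F}) (prodSpace l m)
  rw [hinf, finrank_bot, finrank_span_singleton hF0, finrank_prodSpace hl] at this
  omega

theorem map_restrict_prodSpace {e : ℕ} (l : Fin e → Module.Dual ℂ E) (m : ℕ)
    (H : Submodule ℂ E) :
    (prodSpace l m).map (restrict H) = prodSpace (fun i => (l i).comp H.subtype) m := by
  ext f
  rw [mem_prodSpace]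
  constructor
  · rintro ⟨_, ⟨g, hg, rfl⟩, rfl⟩
    exact ⟨restrict H g, restrict_mem_forms hg H, fun v => rfl⟩
  · rintro ⟨g, hg, h⟩
    obtain ⟨g', hg', rfl⟩ := exists_restrict_eq H hg
    exact ⟨_, ⟨g', hg', rfl⟩, (funext h).symm⟩

theorem exists_dual_ker_eq [FiniteDimensional ℂ E] {H : Submodule ℂ E}
    (hH : Module.finrank ℂ H + 1 = Module.finrank ℂ E) :
    ∃ l : Module.Dual ℂ E, LinearMap.ker l = H := by
  have h1 : Module.finrank ℂ (E ⧸ H) = Module.finrank ℂ ℂ := by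
    have := H.finrank_quotient_add_finrank
    rw [Module.finrank_self]
    omega
  refine ⟨(LinearEquiv.ofFinrankEq _ _ h1).toLinearMap.comp H.mkQ, ?_⟩
  rw [LinearEquiv.ker_comp, Submodule.ker_mkQ]

theorem exists_hypersurface_eqn_eq {d : ℕ} {s : E → ℂ} (hs : s ∈ forms E d) (h0 : s ≠ 0) :
    ∃ X : Hypersurface E d, ∃ c : ℂ, c ≠ 0 ∧ X.eqn = c • s := by
  have h0' : (⟨s, hs⟩ : forms E d) ≠ 0 := fun h => h0 (congrArg Subtype.val h)
  obtain ⟨c, hc⟩ := Projectivization.exists_smul_eq_mk_rep ℂ _ h0'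
  exact ⟨.mk ℂ _ h0', c, c.ne_zero, (congrArg Subtype.val hc).symm⟩

theorem Hypersurface.eqn_mem_forms {d : ℕ} (X : Hypersurface E d) : X.eqn ∈ forms E d :=
  (Projectivization.rep X).2

theorem Hypersurface.eqn_ne_zero {d : ℕ} (X : Hypersurface E d) : X.eqn ≠ 0 := fun h =>
  X.rep_nonzero (Subtype.ext h)

end LinearSystem

/-! ### Structure of the linear system; dimensions and part (iii) -/

section Triples

variable {N d e : ℕ}

theorem Triple.exists_dual (T : Triple N d) :
    ∃ l : Module.Dual ℂ (Coord N), LinearMap.ker l = T.plane :=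
  exists_dual_ker_eq (by rw [T.finrank_plane]; simp)

/-- The equation of the cone does not vanish identically on a hyperplane avoiding the vertex. -/
theorem Triple.exists_mem_cone_ne_zero (T : Triple N d) {H : Submodule ℂ (Coord N)}
    (hH : Module.finrank ℂ H = N) (hT : ¬ T.PointMem H) :
    ∃ v : T.plane, (v : Coord N) ∈ H ∧ T.cone.eqn v ≠ 0 := by
  obtain ⟨l, rfl⟩ := exists_dual_ker_eq (H := H) (by rw [hH]; simp)
  obtain ⟨v, hv⟩ := Function.ne_iff.mp T.cone.eqn_ne_zero
  have hp : l (T.point.rep : Coord N) ≠ 0 := hT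
  -- Slide `v` along the vertex direction until it meets `H`; the cone equation is unchanged.
  refine ⟨v + (-(l v / l (T.point.rep : Coord N))) • T.point.rep, ?_, ?_⟩
  · simp [hp]
  · rw [T.good.cone]
    · exact hv
    · rw [Projectivization.submodule_eq]
      exact Submodule.smul_mem _ _ (Submodule.mem_span_singleton_self _)

theorem mem_sysSpace {L : Fin e → Triple N d} {s : Coord N → ℂ} :
    s ∈ sysSpace L ↔ s ∈ forms (Coord N) d ∧
      ∀ i, ∃ c : ℂ, restrict (L i).plane s = c • (L i).cone.eqn := by
  simp only [sysSpace, Submodule.mem_inf, Submodule.mem_iInf, Submodule.mem_comap,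
    Submodule.mem_span_singleton, eq_comm]

/-- Linear equations of the planes together with a form cutting out the cones. -/
structure Presentation (L : Fin e → Triple N d) where
  l : Fin e → Module.Dual ℂ (Coord N)
  ker_l : ∀ i, LinearMap.ker (l i) = (L i).plane
  F : Coord N → ℂ
  mem_forms : F ∈ forms (Coord N) d
  a : Fin e → ℂ
  a_ne_zero : ∀ i, a i ≠ 0
  restrict_F : ∀ i, restrict (L i).plane F = a i • (L i).cone.eqn

theorem exists_presentation {L : Fin e → Triple N d} (hs : Suited L) :
    Nonempty (Presentation L) := by
  obtain ⟨X, -, hX⟩ := hs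
  choose l hl using fun i => (L i).exists_dual
  choose a ha haX using hX
  exact ⟨⟨l, hl, X.eqn, X.eqn_mem_forms, a, ha, haX⟩⟩

namespace Presentation

variable {L : Fin e → Triple N d}

theorem l_eq_zero_iff (R : Presentation L) (i : Fin e) (v : Coord N) : R.l i v = 0 ↔ v ∈
    (L i).plane := by
  rw [← R.ker_l, LinearMap.mem_ker]

theorem l_ne_zero (R : Presentation L) (i : Fin e) : R.l i ≠ 0 := by
  intro h
  have h1 := R.ker_l i
  have h2 := (L i).finrank_plane
  rw [h, LinearMap.ker_zero] at h1
  rw [← h1, finrank_top] at h2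
  simp at h2

theorem F_mem (R : Presentation L) : R.F ∈ sysSpace L :=
  mem_sysSpace.mpr ⟨R.mem_forms, fun i => ⟨R.a i, R.restrict_F i⟩⟩

theorem F_apply (R : Presentation L) (i : Fin e) (v : (L i).plane) : R.F v = R.a i *
    (L i).cone.eqn v :=
  congrFun (R.restrict_F i) v

theorem exists_F_ne_zero (R : Presentation L) (i : Fin e) {H : Submodule ℂ (Coord N)}
    (hH : Module.finrank ℂ H = N) (hi : ¬ (L i).PointMem H) :
    ∃ v ∈ H, R.l i v = 0 ∧ R.F v ≠ 0 := by
  obtain ⟨v, hv, hv'⟩ := (L i).exists_mem_cone_ne_zero hH hi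
  exact ⟨v, hv, (R.l_eq_zero_iff i v).mpr v.2, by
    rw [R.F_apply]; exact mul_ne_zero (R.a_ne_zero i) hv'⟩

theorem l_comp_subtype_ne_zero (R : Presentation L) (i : Fin e) {H : Submodule ℂ (Coord N)}
    (hH : Module.finrank ℂ H = N) (hi : ¬ (L i).PointMem H) :
    (R.l i).comp H.subtype ≠ 0 := by
  intro h
  have hle : H ≤ (L i).plane := fun v hv =>
    (R.l_eq_zero_iff i v).mp (LinearMap.congr_fun h ⟨v, hv⟩)
  have := Submodule.eq_of_le_of_finrank_eq hle (hH.trans (L i).finrank_plane.symm)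
  exact hi (this ▸ (L i).point.rep.2)

theorem exists_l_ne_zero (R : Presentation L) (hL : PointsOffPlanes L) {i j : Fin e} (hij : i ≠ j) :
    ∃ v, R.l i v = 0 ∧ R.l j v ≠ 0 :=
  ⟨((L i).point.rep : Coord N), (R.l_eq_zero_iff i _).mpr (L i).point.rep.2,
    fun h => hL i j hij ((R.l_eq_zero_iff j _).mp h)⟩

/-- Each member of the system is, up to a multiple of `F`, zero on all the planes. -/
theorem exists_sub_vanish (R : Presentation L) (hL : PointsOffPlanes L) {s : Coord N → ℂ}
    (hs : s ∈ sysSpace L) :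
    ∃ b : ℂ, ∀ i v, R.l i v = 0 → s v = b * R.F v := by
  obtain ⟨-, h⟩ := mem_sysSpace.mp hs
  choose c hc using h
  have hb : ∀ i v, R.l i v = 0 → s v = c i / R.a i * R.F v := by
    intro i v hv
    have h1 := congrFun (hc i) ⟨v, (R.l_eq_zero_iff i v).mp hv⟩
    have h2 := R.F_apply i ⟨v, (R.l_eq_zero_iff i v).mp hv⟩
    have h3 := R.a_ne_zero i
    simp only [restrict, LinearMap.funLeft_apply, Pi.smul_apply, smul_eq_mul] at h1
    rw [h1, h2]
    field_simp
  rcases Nat.eq_zero_or_pos e with rfl | he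
  · exact ⟨0, fun i => i.elim0⟩
  refine ⟨c ⟨0, he⟩ / R.a ⟨0, he⟩, fun i v hv => ?_⟩
  by_cases hi : i = ⟨0, he⟩
  · subst hi
    exact hb _ v hv
  -- `w` lies on both planes and `F w ≠ 0`, so the two ratios `s / F` coincide.
  obtain ⟨w, hw, hw', hFw⟩ := R.exists_F_ne_zero i (L ⟨0, he⟩).finrank_plane (hL i _ hi)
  have h1 := hb i w hw'
  rw [hb ⟨0, he⟩ w ((R.l_eq_zero_iff _ w).mpr hw)] at h1
  rw [mul_right_cancel₀ hFw h1]
  exact hb i v hv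

theorem prodSpace_le (R : Presentation L) (hed : e ≤ d) : prodSpace R.l (d - e) ≤ sysSpace L := by
  rintro _ ⟨g, hg, rfl⟩
  refine mem_sysSpace.mpr ⟨?_, fun i => ⟨0, ?_⟩⟩
  · have := prod_mul_mem_forms R.l hg
    rwa [Nat.add_sub_cancel' hed] at this
  · ext v
    have : ∏ j, R.l j v = 0 :=
      Finset.prod_eq_zero (Finset.mem_univ i) ((R.l_eq_zero_iff i v).mpr v.2)
    simp [restrict, LinearMap.funLeft_apply, this]

theorem sysSpace_eq (R : Presentation L) (hL : PointsOffPlanes L) (hed : e ≤ d) :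
    sysSpace L = Submodule.span ℂ {R.F} ⊔ prodSpace R.l (d - e) := by
  apply le_antisymm
  · intro s hs
    obtain ⟨b, hb⟩ := R.exists_sub_vanish hL hs
    have hf : s - b • R.F ∈ forms (Coord N) d :=
      sub_mem (mem_sysSpace.mp hs).1 (Submodule.smul_mem _ _ R.mem_forms)
    refine Submodule.mem_sup.mpr ⟨b • R.F, Submodule.mem_span_singleton.mpr ⟨b, rfl⟩,
      s - b • R.F, ?_, by simp⟩
    rw [mem_prodSpace]
    rcases exists_eq_prod_mul_of_vanish R.l R.l_ne_zero (fun i j => R.exists_l_ne_zero hL) hf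
      (fun i v hv => by simp [hb i v hv]) with h | ⟨m, rfl, g, hg, h⟩
    · exact ⟨0, zero_mem _, fun v => by rw [h]; simp⟩
    · exact ⟨g, by simpa using hg, h⟩
  · exact sup_le ((Submodule.span_singleton_le_iff_mem _ _).mpr R.F_mem) (R.prodSpace_le hed)

theorem sysSpace_eq_of_lt (R : Presentation L) (hL : PointsOffPlanes L) (hed : d < e) :
    sysSpace L = Submodule.span ℂ {R.F} := by
  apply le_antisymm
  · intro s hs
    obtain ⟨b, hb⟩ := R.exists_sub_vanish hL hs
    have hf : s - b • R.F ∈ forms (Coord N) d :=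
      sub_mem (mem_sysSpace.mp hs).1 (Submodule.smul_mem _ _ R.mem_forms)
    rcases exists_eq_prod_mul_of_vanish R.l R.l_ne_zero (fun i j => R.exists_l_ne_zero hL) hf
      (fun i v hv => by simp [hb i v hv]) with h | ⟨m, h, -⟩
    · exact Submodule.mem_span_singleton.mpr ⟨b, (sub_eq_zero.mp h).symm⟩
    · omega
  · exact (Submodule.span_singleton_le_iff_mem _ _).mpr R.F_mem

theorem exists_zero_F_ne_zero (R : Presentation L) (i : Fin e) : ∃ v, R.l i v = 0 ∧ R.F v ≠ 0 := by
  obtain ⟨v, hv⟩ := Function.ne_iff.mp (L i).cone.eqn_ne_zero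
  exact ⟨v, (R.l_eq_zero_iff i v).mpr v.2, by
    rw [R.F_apply]; exact mul_ne_zero (R.a_ne_zero i) hv⟩

theorem projDim_sysSpace (R : Presentation L) (hL : PointsOffPlanes L) (he : 1 ≤ e) :
    projDim (sysSpace L) = if e ≤ d then (((d - e + N).choose N : ℕ) : ℤ) else 0 := by
  obtain ⟨v, hv, hFv⟩ := R.exists_zero_F_ne_zero ⟨0, he⟩
  split_ifs with hed
  · rw [projDim, R.sysSpace_eq hL hed, finrank_span_sup_prodSpace R.l_ne_zero _ ⟨_, v, hv, hFv⟩,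
      finrank_forms (Pi.basisFun ℂ (Fin (N + 1)))]
    have : N + 1 + (d - e) - 1 = d - e + N := by omega
    rw [this, Nat.choose_symm_add]
    simp
  · rw [projDim, R.sysSpace_eq_of_lt hL (by omega),
      finrank_span_singleton (fun h => hFv (by simp [h]))]
    simp

theorem restrictedSpace_eq (R : Presentation L) (hL : PointsOffPlanes L) (hed : e ≤ d)
    (H : Submodule ℂ (Coord N)) :
    restrictedSpace L H = Submodule.span ℂ {restrict H R.F} ⊔
      prodSpace (fun i => (R.l i).comp H.subtype) (d - e) := by
  rw [restrictedSpace, R.sysSpace_eq hL hed, Submodule.map_sup, Submodule.map_span,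
    Set.image_singleton, map_restrict_prodSpace]

theorem projDim_restrictedSpace (R : Presentation L) (hL : PointsOffPlanes L) (hN : 2 ≤ N)
    (he : 1 ≤ e) (hed : e ≤ d)
    {H : Submodule ℂ (Coord N)} (hH : Module.finrank ℂ H = N) (hP : ∀ i, ¬ (L i).PointMem H) :
    projDim (restrictedSpace L H) = (((d - e + N - 1).choose (N - 1) : ℕ) : ℤ) := by
  obtain ⟨v, hvH, hv, hFv⟩ := R.exists_F_ne_zero ⟨0, he⟩ hH (hP _)
  rw [projDim, R.restrictedSpace_eq hL hed,
    finrank_span_sup_prodSpace (fun i => R.l_comp_subtype_ne_zero i hH (hP i)) _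
      ⟨⟨0, he⟩, ⟨v, hvH⟩, hv, hFv⟩,
    finrank_forms (Module.finBasisOfFinrankEq ℂ H hH)]
  have : d - e + N - 1 = d - e + (N - 1) := by omega
  rw [this, ← Nat.choose_symm_add, show N + (d - e) - 1 = d - e + (N - 1) by omega]
  simp

theorem projDim_restrictedSpace_of_lt (R : Presentation L) (hL : PointsOffPlanes L) (he : 1 ≤ e)
    (hed : d < e)
    {H : Submodule ℂ (Coord N)} (hH : Module.finrank ℂ H = N) (hP : ∀ i, ¬ (L i).PointMem H) :
    projDim (restrictedSpace L H) = 0 := by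
  obtain ⟨v, hvH, hv, hFv⟩ := R.exists_F_ne_zero ⟨0, he⟩ hH (hP _)
  rw [projDim, restrictedSpace, R.sysSpace_eq_of_lt hL hed, Submodule.map_span,
    Set.image_singleton, finrank_span_singleton (fun h => hFv (congrFun h ⟨v, hvH⟩))]
  simp

/-- Equations of `Π ∩ Π_i` in `Π` are unique up to scalars, which `g` absorbs. -/
theorem prod_mul_mem_restrictedSpace (R : Presentation L) (hed : e ≤ d)
    {H : Submodule ℂ (Coord N)} (l : Fin e → Module.Dual ℂ H)
    (hl : ∀ i, LinearMap.ker (l i) = (L i).plane.comap H.subtype) {g : H → ℂ}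
    (hg : g ∈ forms H (d - e)) :
    (fun v => (∏ i, l i v) * g v) ∈ restrictedSpace L H := by
  have hc : ∀ i, ∃ c : ℂ, l i = c • (R.l i).comp H.subtype := by
    intro i
    have hker : LinearMap.ker ((R.l i).comp H.subtype) ≤ LinearMap.ker (l i) := by
      rw [hl, LinearMap.ker_comp, R.ker_l]
    have hmem := mem_span_of_iInf_ker_le_ker (L := fun _ : Unit => (R.l i).comp H.subtype)
      (K := l i) (by simpa using hker)
    rw [Set.range_const] at hmem
    obtain ⟨c, hc⟩ := Submodule.mem_span_singleton.mp hmem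
    exact ⟨c, hc.symm⟩
  choose c hc using hc
  refine Submodule.map_mono (R.prodSpace_le hed) ?_
  rw [map_restrict_prodSpace, mem_prodSpace]
  refine ⟨(∏ i, c i) • g, Submodule.smul_mem _ _ hg, fun v => ?_⟩
  simp only [hc, LinearMap.smul_apply, smul_eq_mul, Finset.prod_mul_distrib, Pi.smul_apply]
  ring

theorem suited_cons_iff (R : Presentation L) (hL : PointsOffPlanes L) (he : 1 ≤ e) (T : Triple N d)
    (hT : ∀ i, ¬ T.PointMem (L i).plane) :
    Suited (Fin.cons T L : Fin (e + 1) → Triple N d) ↔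
      T.cone.eqn ∈ restrictedSpace L T.plane := by
  constructor
  · rintro ⟨X, -, hX⟩
    obtain ⟨a, ha, haX⟩ : X.InterEq T.plane T.cone := hX 0
    have hmem : X.eqn ∈ sysSpace L := mem_sysSpace.mpr ⟨X.eqn_mem_forms, fun i => by
      obtain ⟨c, -, hc⟩ : X.InterEq (L i).plane (L i).cone := hX i.succ
      exact ⟨c, hc⟩⟩
    refine ⟨a⁻¹ • X.eqn, Submodule.smul_mem _ _ hmem, ?_⟩
    rw [map_smul, haX, smul_smul, inv_mul_cancel₀ ha, one_smul]
  · rintro ⟨s, hs, hsT⟩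
    obtain ⟨b, hb⟩ := R.exists_sub_vanish hL hs
    -- Otherwise `s` vanishes on the first plane, and the new cone would contain its intersection
    -- with `T.plane`, although the vertex of `T` is off that plane.
    have hb0 : b ≠ 0 := by
      rintro rfl
      obtain ⟨v, hv, hv'⟩ := T.exists_mem_cone_ne_zero (L ⟨0, he⟩).finrank_plane (hT _)
      apply hv'
      rw [← hsT]
      exact (hb ⟨0, he⟩ v ((R.l_eq_zero_iff _ _).mpr hv)).trans (zero_mul _)
    have hs0 : s ≠ 0 := by
      rintro rfl
      exact T.cone.eqn_ne_zero (by rw [← hsT, map_zero])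
    obtain ⟨X, c, hc, hX⟩ := exists_hypersurface_eqn_eq (mem_sysSpace.mp hs).1 hs0
    have hinter : ∀ i, X.InterEq ((Fin.cons T L : Fin (e + 1) → Triple N d) i).plane
        ((Fin.cons T L : Fin (e + 1) → Triple N d) i).cone := by
      refine Fin.cases ?_ fun i => ?_
      · exact ⟨c, hc, by rw [hX, map_smul]; exact congrArg (c • ·) hsT⟩
      · refine ⟨c * (b * R.a i), mul_ne_zero hc (mul_ne_zero hb0 (R.a_ne_zero i)), ?_⟩
        rw [hX, map_smul, mul_smul, mul_smul]
        congr 1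
        change restrict (L i).plane s = b • R.a i • (L i).cone.eqn
        rw [← R.restrict_F]
        ext v
        exact hb i v ((R.l_eq_zero_iff i v).mpr v.2)
    refine ⟨X, fun i hi => ?_, hinter⟩
    obtain ⟨a, ha, h⟩ := hinter i
    rw [Hypersurface.Contains, h] at hi
    exact (smul_ne_zero ha (Hypersurface.eqn_ne_zero _)) hi

end Presentation

end Triples

/-! ### Directional derivatives and Bertini for systems of forms -/

section Singular

variable {E : Type*} [AddCommGroup E] [Module ℂ E]

theorem form_differentiableAt_line {d : ℕ} {f : E → ℂ} (hf : f ∈ forms E d) (v w : E) (t : ℂ) :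
    DifferentiableAt ℂ (fun t : ℂ => f (v + t • w)) t := by
  obtain ⟨p, hp⟩ := exists_polynomial_on_line hf v w
  simp only [hp]
  exact p.differentiableAt

theorem IsSingularAt.smul {d : ℕ} {f : E → ℂ} (hf : f ∈ forms E d) {v : E}
    (h : IsSingularAt f v) {c : ℂ} (hc : c ≠ 0) : IsSingularAt f (c • v) := by
  refine ⟨by rw [form_smul hf, h.1, mul_zero], fun w => ?_⟩
  have h1 : (fun t : ℂ => f (c • v + t • w)) = fun t => c ^ d * f (v + t • (c⁻¹ • w)) := by
    ext t
    rw [← form_smul hf, smul_add, smul_comm t, smul_inv_smul₀ hc]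
  have h2 : deriv (fun t : ℂ => f (v + t • (c⁻¹ • w))) 0 = 0 := h.2 (c⁻¹ • w)
  rw [lineDeriv, h1, deriv_const_mul _ (form_differentiableAt_line hf _ _ _), h2, mul_zero]

theorem lineDeriv_dual_mul (l : Module.Dual ℂ E) {d : ℕ} {g : E → ℂ} (hg : g ∈ forms E d)
    {p : E} (hp : l p = 0) (w : E) :
    lineDeriv ℂ (fun v => l v * g v) p w = l w * g p := by
  have h1 : HasDerivAt (fun t : ℂ => t * l w) (l w) 0 := by
    simpa using (hasDerivAt_id (0 : ℂ)).mul_const (l w)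
  have h2 := h1.mul (form_differentiableAt_line hg p w 0).hasDerivAt
  have h3 : (fun t : ℂ => l (p + t • w) * g (p + t • w)) =
      (fun t : ℂ => t * l w) * fun t : ℂ => g (p + t • w) := by
    ext t
    simp [hp]
  rw [lineDeriv, h3, h2.deriv]
  simp

/-- The directional derivative as a linear functional on a space of forms. -/
noncomputable def lineDerivDual {d : ℕ} {V : Submodule ℂ (E → ℂ)} (hV : V ≤ forms E d)
    (p w : E) : Module.Dual ℂ V where
  toFun s := lineDeriv ℂ (s : E → ℂ) p w
  map_add' s s' := deriv_add (form_differentiableAt_line (hV s.2) p w 0)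
    (form_differentiableAt_line (hV s'.2) p w 0)
  map_smul' c s := deriv_const_mul c (form_differentiableAt_line (hV s.2) p w 0)

/-- Links the analytic Jacobian criterion to the formal derivatives used in Bertini. -/
theorem lineDeriv_eval_single {n : ℕ} (p : MvPolynomial (Fin n) ℂ) (v : Fin n → ℂ) (j : Fin n) :
    lineDeriv ℂ (fun x => eval x p) v (Pi.single j 1) = eval v (pderiv j p) := by
  classical
  refine HasDerivAt.deriv ?_
  induction p using MvPolynomial.induction_on with
  | C a => simpa using hasDerivAt_const (0 : ℂ) a
  | add p q hp hq => simpa using! hp.add hq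
  | mul_X p i hp =>
    have h1 : HasDerivAt (fun t : ℂ => v i + t * (Pi.single j 1 : Fin n → ℂ) i)
        ((Pi.single j 1 : Fin n → ℂ) i) 0 := by
      simpa using ((hasDerivAt_id (0 : ℂ)).mul_const
        ((Pi.single j 1 : Fin n → ℂ) i)).const_add (v i)
    have h2 := hp.mul h1
    refine (h2.congr_deriv ?_).congr_of_eventuallyEq (.of_forall fun t => ?_)
    · rw [Derivation.leibniz, pderiv_X]
      by_cases hij : i = j
      · subst hij; simp; ring
      · simp [Pi.single_eq_of_ne hij, mul_comm]
    · simp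

/-- Along `c ↦ c • x`, `q` is a polynomial in `c` whose `k`-th coefficient is nonzero. This lets a
homogeneous component replace Bertini's inhomogeneous `q`, as Zariski open sets of `ℙ(V)` require.
-/
theorem exists_eval_smul_ne_zero {ι : Type*} {q : MvPolynomial ι ℂ} {k : ℕ} {x : ι → ℂ}
    (h : eval x (homogeneousComponent k q) ≠ 0) : ∃ c : ℂ, c ≠ 0 ∧ eval (c • x) q ≠ 0 := by
  by_contra! hq
  let P : Polynomial ℂ := ∑ j ∈ Finset.range (q.totalDegree + 1),
    Polynomial.C (eval x (homogeneousComponent j q)) * Polynomial.X ^ j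
  have hP : ∀ c : ℂ, P.eval c = eval (c • x) q := by
    intro c
    conv_rhs => rw [← sum_homogeneousComponent q]
    rw [map_sum, Polynomial.eval_finsetSum]
    refine Finset.sum_congr rfl fun j _ => ?_
    have := form_smul (eval_mem_forms (fun i => LinearMap.proj (φ := fun _ : ι => ℂ) i)
      (homogeneousComponent_isHomogeneous j q)) c x
    rw [Polynomial.eval_mul, Polynomial.eval_C, Polynomial.eval_pow, Polynomial.eval_X, mul_comm]
    exact this.symm
  -- The factor `X` covers `c = 0`, where nothing is known about `P`.
  have hXP : Polynomial.X * P = 0 := Polynomial.funext fun c => by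
    by_cases hc : c = 0
    · simp [hc]
    · simp [hP, hq c hc]
  have hP0 : P = 0 := (mul_eq_zero.mp hXP).resolve_left Polynomial.X_ne_zero
  have hk : k < q.totalDegree + 1 := by
    by_contra! hk
    exact h (by rw [homogeneousComponent_eq_zero _ _ (by omega), map_zero])
  have := congrArg (fun p => Polynomial.coeff p k) hP0
  simp only [P, Polynomial.finsetSum_coeff, Polynomial.coeff_C_mul, Polynomial.coeff_X_pow,
    mul_ite, mul_one, mul_zero, Finset.sum_ite_eq, Finset.mem_range, hk, if_true,
    Polynomial.coeff_zero] at this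
  exact h this

/-- Bertini's theorem for linear systems of forms: the members with singular points outside
the base locus lie on a hypersurface. -/
theorem exists_form_singular_imp_base {n d : ℕ} {V : Submodule ℂ ((Fin n → ℂ) → ℂ)}
    (hV : V ≤ forms (Fin n → ℂ) d) :
    ∃ k, ∃ φ ∈ forms V k, φ ≠ 0 ∧ ∀ s : V, φ s ≠ 0 → ∀ v : Fin n → ℂ,
      IsSingularAt (s : (Fin n → ℂ) → ℂ) v → ∀ s' ∈ V, s' v = 0 := by
  have := forms_finite (E := Fin n → ℂ) d
  have : FiniteDimensional ℂ V := Submodule.finiteDimensional_of_le hV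
  let B := Module.finBasis ℂ V
  have hb : ∀ i, ∃ b : MvPolynomial (Fin n) ℂ, ∀ v, eval v b = (B i : (Fin n → ℂ) → ℂ) v := by
    intro i
    have := hV (B i).2
    rw [← map_polyFun_homogeneousSubmodule (Pi.basisFun ℂ (Fin n))] at this
    obtain ⟨b, -, hb⟩ := this
    exact ⟨b, fun v => congrFun hb v⟩
  choose b hb using hb
  have hsum : ∀ (s : V) v, eval v (∑ i, B.coord i s • b i) = (s : (Fin n → ℂ) → ℂ) v := by
    intro s v
    have h := congrArg (fun s : V => (s : (Fin n → ℂ) → ℂ) v) (B.sum_repr s)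
    simp only [Submodule.coe_sum, Finset.sum_apply, Submodule.coe_smul, Pi.smul_apply] at h
    simpa only [map_sum, smul_eval, hb, smul_eq_mul] using! h
  obtain ⟨q, hq0, hq⟩ := exists_singular_imp_base b
  obtain ⟨k, hk⟩ : ∃ k, homogeneousComponent k q ≠ 0 := by
    by_contra! h
    exact hq0 (by rw [← sum_homogeneousComponent q]; simp [h])
  refine ⟨k, polyFun B (homogeneousComponent k q), eval_mem_forms _
    (homogeneousComponent_isHomogeneous k q), fun h => hk (polyFun_injective B (by simpa using h)),
    fun s hs v hsing s' hs' => ?_⟩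
  obtain ⟨c, hc0, hc⟩ : ∃ c : ℂ, c ≠ 0 ∧ eval (fun i => B.coord i (c • s)) q ≠ 0 := by
    obtain ⟨c, hc0, hc⟩ := exists_eval_smul_ne_zero hs
    exact ⟨c, hc0, by simpa only [map_smul] using! hc⟩
  have hsing' : IsSingularAt ((c • s : V) : (Fin n → ℂ) → ℂ) v :=
    ⟨by simp [hsing.1], fun w => (deriv_const_mul c
      (form_differentiableAt_line (hV s.2) v w 0)).trans (by
        rw [← lineDeriv, hsing.2 w, mul_zero])⟩
  have hfun : ((c • s : V) : (Fin n → ℂ) → ℂ) =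
      fun x => eval x (∑ i, B.coord i (c • s) • b i) := funext fun x => (hsum _ x).symm
  have hbase := hq _ hc v ((hsum _ v).trans hsing'.1) fun j => by
    rw [← lineDeriv_eval_single, ← hfun]
    exact hsing'.2 _
  exact (hsum ⟨s', hs'⟩ v).symm.trans (by simp [hbase])

theorem generalMember_of_form {V : Submodule ℂ (E → ℂ)} {p : (E → ℂ) → Prop} {k : ℕ}
    {φ : V → ℂ} (hφ : φ ∈ forms V k) {s : V} (hs0 : s ≠ 0) (hs : φ s ≠ 0)
    (h : ∀ s : V, φ s ≠ 0 → p s) : GeneralMember V p := by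
  refine ⟨{x | φ x.rep ≠ 0}, ⟨{φ}, by simpa using ⟨k, hφ⟩, by ext x; simp⟩,
    ⟨.mk ℂ s hs0, ?_⟩, fun x hx => h _ hx⟩
  obtain ⟨c, hc⟩ := Projectivization.exists_smul_eq_mk_rep ℂ s hs0
  rw [Set.mem_ofPred_eq, ← hc, Units.smul_def, form_smul hφ]
  exact mul_ne_zero (pow_ne_zero _ c.ne_zero) hs

end Singular

/-- Derivatives of `s` along the plane are `c` times those of the cone equation, and the cone is
smooth off its vertex. -/
theorem Triple.mem_point_of_singular {N d : ℕ} (T : Triple N d) {s : Coord N → ℂ} {c : ℂ}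
    (hc : c ≠ 0) (hs : restrict T.plane s = c • T.cone.eqn) {v : T.plane}
    (h : IsSingularAt s (v : Coord N)) : v ∈ T.point.submodule := by
  by_contra hv
  refine T.good.smooth v hv ?_
  have heq : T.cone.eqn = c⁻¹ • restrict T.plane s := by
    rw [hs, smul_smul, inv_mul_cancel₀ hc, one_smul]
  have h1 : ∀ w : T.plane, deriv (fun t : ℂ => c⁻¹ * s ((v : Coord N) + t • (w : Coord N))) 0
      = 0 := by
    intro w
    rw [deriv_const_mul_field]
    exact mul_eq_zero_of_right _ (h.2 w)
  rw [heq]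
  exact ⟨by simpa [restrict, LinearMap.funLeft_apply] using Or.inr h.1, h1⟩

/-! ### Smoothness of the general member -/

namespace Presentation

variable {N d e : ℕ} {L : Fin e → Triple N d}

/-- For each plane the derivative transversal to the plane at the vertex is a nonzero functional
on the system. -/
theorem exists_lineDeriv_ne_zero (R : Presentation L) (hL : PointsOffPlanes L) (hed : e ≤ d)
    (i : Fin e) : ∃ w, ∃ s ∈ sysSpace L, lineDeriv ℂ s ((L i).point.rep : Coord N) w ≠ 0 := by
  obtain ⟨w, hw⟩ : ∃ w, R.l i w ≠ 0 := DFunLike.ne_iff.mp (R.l_ne_zero i)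
  have hp0 : ((L i).point.rep : Coord N) ≠ 0 := by simpa using (L i).point.rep_nonzero
  obtain ⟨g, hg, hgp⟩ := exists_form_ne_zero (d - e) hp0
  -- For `(∏ l j) * g` the derivative at `P_i` is `l i w` times the other factors at `P_i`; these
  -- are nonzero since `P_i ∉ Π_j` and `g` was chosen nonzero there.
  refine ⟨w, _, R.prodSpace_le hed ⟨g, hg, rfl⟩, ?_⟩
  have hcomp : (LinearMap.mulLeft ℂ fun v => ∏ j, R.l j v) g =
      fun v => R.l i v * ((∏ j ∈ Finset.univ.erase i, R.l j v) * g v) := by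
    ext v
    rw [← mul_assoc, Finset.mul_prod_erase _ (fun j => R.l j v) (Finset.mem_univ i)]
    rfl
  have hprod : (fun v => ∏ j ∈ Finset.univ.erase i, R.l j v) ∈
      forms (Coord N) (Finset.univ.erase i).card := by
    have h := IsHomogeneous.prod (Finset.univ.erase i) (fun j => (X j : MvPolynomial (Fin e) ℂ))
      (fun _ => 1) fun j _ => isHomogeneous_X ℂ j
    rw [Finset.sum_const, smul_eq_mul, mul_one] at h
    simpa only [map_prod, eval_X] using eval_mem_forms R.l h
  have hderiv := lineDeriv_dual_mul (R.l i) (mul_mem_forms hprod hg)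
    ((R.l_eq_zero_iff i _).mpr (L i).point.rep.2) w
  rw [hcomp]
  refine ne_of_eq_of_ne hderiv ?_
  refine mul_ne_zero hw (mul_ne_zero (Finset.prod_ne_zero_iff.mpr fun j hj => ?_) hgp)
  exact fun h => hL i j (Finset.ne_of_mem_erase hj).symm ((R.l_eq_zero_iff j _).mp h)

theorem generalMember_isSmooth (R : Presentation L) (hL : PointsOffPlanes L) (he : 1 ≤ e)
    (hed : e ≤ d) : GeneralMember (sysSpace L) IsSmooth := by
  have hV : sysSpace L ≤ forms (Coord N) d := inf_le_left
  obtain ⟨k, φ, hφ, hφ0, hbase⟩ := exists_form_singular_imp_base hV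
  obtain ⟨v₀, hv₀, hFv₀⟩ := R.exists_zero_F_ne_zero ⟨0, he⟩
  choose w s hs hsw using R.exists_lineDeriv_ne_zero hL hed
  -- The open set is the nonvanishing locus of `φ * (∏ δ i) * α`: `φ` confines singularities to base
  -- points, `δ i` excludes `P_i`, and `α` forces `b ≠ 0`.
  let α : Module.Dual ℂ (sysSpace L) := (LinearMap.proj v₀).comp (sysSpace L).subtype
  let δ : Fin e → Module.Dual ℂ (sysSpace L) := fun i =>
    lineDerivDual hV ((L i).point.rep : Coord N) (w i)
  have hδ : ∀ i, δ i ≠ 0 := fun i h => hsw i (LinearMap.congr_fun h ⟨s i, hs i⟩)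
  have hα : α ≠ 0 := fun h => hFv₀ (LinearMap.congr_fun h ⟨R.F, R.F_mem⟩)
  have hψ := mul_mem_forms (prod_mem_forms δ) (dual_mem_forms α)
  have hψ0 : (fun s => ∏ i, δ i s) * (fun s => α s) ≠ 0 := fun h => by
    rcases forms_mul_eq_zero (prod_mem_forms δ) (dual_mem_forms α) (congrFun h) with h | h
    · exact prod_dual_ne_zero hδ h
    · exact hα (LinearMap.ext fun s => congrFun h s)
  have hχ0 : φ * ((fun s => ∏ i, δ i s) * (fun s => α s)) ≠ 0 := fun h => by
    rcases forms_mul_eq_zero hφ hψ (congrFun h) with h | h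
    · exact hφ0 h
    · exact hψ0 h
  obtain ⟨s₀, hs₀⟩ := Function.ne_iff.mp hχ0
  refine generalMember_of_form (mul_mem_forms hφ hψ) (s := s₀) ?_ hs₀ ?_
  · rintro rfl
    simp at hs₀
  rintro ⟨f, hf⟩ hne v hv0 hsing
  simp only [Pi.mul_apply, ne_eq, mul_eq_zero, not_or, Finset.prod_eq_zero_iff, not_exists,
    Finset.mem_univ, true_and] at hne
  obtain ⟨hφf, hδf, hαf⟩ := hne
  have hb := hbase _ hφf v hsing
  obtain ⟨g, hg, hgv⟩ := exists_form_ne_zero (d - e) hv0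
  -- Testing the base point `v` on a multiple with `g v ≠ 0` puts it on some `Π_i`.
  have hprod : (∏ i, R.l i v) * g v = 0 := hb _ (R.prodSpace_le hed ⟨g, hg, rfl⟩)
  obtain ⟨i, -, hi⟩ := Finset.prod_eq_zero_iff.mp ((mul_eq_zero.mp hprod).resolve_right hgv)
  obtain ⟨b, hbf⟩ := R.exists_sub_vanish hL hf
  have hb0 : b ≠ 0 := by
    rintro rfl
    exact hαf ((hbf _ v₀ hv₀).trans (zero_mul _))
  have hrestr : restrict (L i).plane f = (b * R.a i) • (L i).cone.eqn := by
    rw [mul_smul, ← R.restrict_F]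
    ext x
    exact hbf i x ((R.l_eq_zero_iff i x).mpr x.2)
  have hvP := (L i).mem_point_of_singular (mul_ne_zero hb0 (R.a_ne_zero i)) hrestr
    (v := ⟨v, (R.l_eq_zero_iff i v).mp hi⟩) hsing
  rw [Projectivization.submodule_eq, Submodule.mem_span_singleton] at hvP
  obtain ⟨c, hc⟩ := hvP
  have hcv : c • ((L i).point.rep : Coord N) = v := congrArg Subtype.val hc
  have hc0 : c ≠ 0 := by
    rintro rfl
    exact hv0 (by rw [← hcv, zero_smul])
  have hsingP : IsSingularAt f ((L i).point.rep : Coord N) := by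
    have := hsing.smul (hV hf) (inv_ne_zero hc0)
    rwa [← hcv, inv_smul_smul₀ hc0] at this
  exact hδf i (hsingP.2 (w i))

end Presentation

end StarPoints

/-! ### The theorem -/

theorem mainTheorem1 (N d e : ℕ) (hN : 2 ≤ N) (hd : 3 ≤ d) (he : 1 ≤ e)
    (L : Fin e → StarPoints.Triple N d)
    (hL : StarPoints.PointsOffPlanes L) (hs : StarPoints.Suited L) :
    -- (i)
    (StarPoints.projDim (StarPoints.sysSpace L) =
        (if e ≤ d then (((d - e + N).choose N : ℕ) : ℤ) else 0) ∧
      (e ≤ d → StarPoints.GeneralMember (StarPoints.sysSpace L) StarPoints.IsSmooth)) ∧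
    -- (ii)
    (∀ H : Submodule ℂ (StarPoints.Coord N), Module.finrank ℂ H = N →
      (∀ i, ¬ (L i).PointMem H) →
      (e ≤ d →
        StarPoints.projDim (StarPoints.restrictedSpace L H) =
          (((d - e + N - 1).choose (N - 1) : ℕ) : ℤ) ∧
        ∀ l : Fin e → Module.Dual ℂ H,
          (∀ i, LinearMap.ker (l i) = (L i).plane.comap H.subtype) →
          ∀ g ∈ StarPoints.forms H (d - e),
            (fun v => (∏ i, l i v) * g v) ∈ StarPoints.restrictedSpace L H) ∧
      (d < e → StarPoints.projDim (StarPoints.restrictedSpace L H) = 0)) ∧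
    -- (iii)
    (∀ T : StarPoints.Triple N d,
      (∀ i, ¬ (L i).PointMem T.plane) → (∀ i, ¬ T.PointMem (L i).plane) →
      (StarPoints.Suited (Fin.cons T L : Fin (e + 1) → StarPoints.Triple N d) ↔
        T.cone.eqn ∈ StarPoints.restrictedSpace L T.plane)) := by
  obtain ⟨R⟩ := StarPoints.exists_presentation hs
  refine ⟨⟨R.projDim_sysSpace hL he, R.generalMember_isSmooth hL he⟩,
    fun H hH hP => ⟨fun hed => ⟨R.projDim_restrictedSpace hL hN he hed hH hP,
      fun l hl g hg => R.prod_mul_mem_restrictedSpace hed l hl hg⟩,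
      fun hed => R.projDim_restrictedSpace_of_lt hL he hed hH hP⟩,
    fun T _ hT => R.suited_cons_iff hL he T hT⟩
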